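/- Let $SL(2)=SL(2,\mathbb C)$ act on the space $S^4(\mathbb C^2)$ of binary quartic forms $$f=f_0x^4+4f_1x^3y+6f_2x^2y^2+4f_3xy^3+f_4y^4,\qquad f_0,\dots,f_4\in\mathbb C,$$ by linear substitution of the variables $x,y$. An invariant of degree $m$ is a homogeneous polynomial $P\in\mathbb C[f_0,\dots,f_4]$ of degree $m$ such that $P(g\cdot f)=P(f)$ for every $g\in SL(2)$ and every binary quartic $f$, and the ring of invariants, also written $\bigoplus_m S^m(S^4(\mathbb C^2))^{SL(2)}$, consists of all polynomials in $\mathbb C[f_0,\dots,f_4]$ satisfying $P(g\cdot f)=P(f)$. Let $$I=f_0f_4-4f_1f_3+3f_2^2,\qquad J=\det\begin{pmatrix}f_0&f_1&f_2\\ f_1&f_2&f_3\\ f_2&f_3&f_4\end{pmatrix},$$ which are homogeneous of degree $2$ and $3$ respectively. Then, with $d_m$ the dimension of the space of invariants of degree $m$, $$\sum_{m=0}^{\infty}d_m\,x^m=\frac{1}{(1-x^2)(1-x^3)}$$ as formal power series, and the ring of invariants is freely generated by $I$ and $J$: the polynomials $I$ and $J$ are algebraically independent over $\mathbb C$ and $$\bigoplus_m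 S^m(S^4(\mathbb C^2))^{SL(2)}=\mathbb C[I,J].$$ -/

import Mathlib

noncomputable section

open MvPolynomial
open scoped MatrixGroups

namespace BinaryForms

/-- The linear substitution `x_j ↦ ∑ i, g i j • x_i` on `ℂ[x_0, x_1]`, i.e. the extension to the
symmetric algebra of the standard action of `SL(2, ℂ)` on `ℂ²` with basis `x_0, x_1`. -/
def subst (g : SL(2, ℂ)) : MvPolynomial (Fin 2) ℂ →ₐ[ℂ] MvPolynomial (Fin 2) ℂ :=
  aeval fun j => ∑ i, C (g i j) * X i

theorem subst_one : subst 1 = AlgHom.id ℂ _ := by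
  ext j : 1
  fin_cases j <;> simp [subst, Fin.sum_univ_two]

theorem subst_mul (g h : SL(2, ℂ)) : subst (g * h) = (subst g).comp (subst h) := by
  ext j : 1
  simp only [subst, aeval_X, AlgHom.comp_apply, map_mul, Fin.sum_univ_two,
    Matrix.SpecialLinearGroup.coe_mul, Matrix.mul_apply, map_add, algHom_C, algebraMap_eq]
  ring

theorem subst_isHomogeneous (g : SL(2, ℂ)) {d : ℕ} {f : MvPolynomial (Fin 2) ℂ}
    (hf : f.IsHomogeneous d) : (subst g f).IsHomogeneous d := by
  have h := hf.aeval (fun j => ∑ i, C (g i j) * X i : Fin 2 → MvPolynomial (Fin 2) ℂ) (n := 1)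
    fun j => IsHomogeneous.sum _ _ _ fun i _ => (isHomogeneous_X ℂ i).C_mul _
  simpa [subst] using h

/-- The space `S^d(ℂ²)` of binary forms of degree `d`. -/
abbrev Form (d : ℕ) : Type := homogeneousSubmodule (Fin 2) ℂ d

/-- The representation of `SL(2, ℂ)` on binary forms of degree `d`. -/
def formRep (d : ℕ) : Representation ℂ SL(2, ℂ) (Form d) where
  toFun g := (subst g).toLinearMap.restrict fun _ hf => subst_isHomogeneous g hf
  map_one' := by
    ext f : 2
    simp [subst_one]
  map_mul' g h := by
    ext f : 2
    simp [subst_mul]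
    rfl

/-- The coefficients `(f_0, …, f_d)` of a binary form, normalised by binomials:
`f = ∑ i, (d choose i) f_i x_0 ^ (d - i) x_1 ^ i`. -/
def coords (d : ℕ) (f : Form d) (i : Fin (d + 1)) : ℂ :=
  coeff (Finsupp.single 0 (d - (i : ℕ)) + Finsupp.single 1 (i : ℕ)) (f : MvPolynomial (Fin 2) ℂ) /
    (d.choose i : ℂ)

/-- The ring of `SL(2)`-invariants of binary forms of degree `d`: the polynomials in the
coefficients `f_0, …, f_d` whose value at a form does not change under the action of `SL(2, ℂ)`. -/
def invariantRing (d : ℕ) : Subalgebra ℂ (MvPolynomial (Fin (d + 1)) ℂ) where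
  carrier := {P | ∀ (g : SL(2, ℂ)) (f : Form d),
    eval (coords d (formRep d g f)) P = eval (coords d f) P}
  mul_mem' hP hQ g f := by rw [map_mul, map_mul, hP g f, hQ g f]
  add_mem' hP hQ g f := by rw [map_add, map_add, hP g f, hQ g f]
  algebraMap_mem' c g f := by simp [algebraMap_eq]

/-- The space of invariants of degree `m` of binary forms of degree `d`. -/
def invariantsOfDegree (d m : ℕ) : Submodule ℂ (MvPolynomial (Fin (d + 1)) ℂ) :=
  Subalgebra.toSubmodule (invariantRing d) ⊓ homogeneousSubmodule (Fin (d + 1)) ℂ m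

/-- The Hilbert series `∑ m, (dim of the invariants of degree m) x ^ m`. -/
def hilbertSeries (d : ℕ) : PowerSeries ℚ :=
  PowerSeries.mk fun m => (Module.finrank ℂ (invariantsOfDegree d m) : ℚ)

/-- The invariant `I = f_0 f_4 - 4 f_1 f_3 + 3 f_2 ^ 2` of binary quartics. -/
def quarticI : MvPolynomial (Fin (4 + 1)) ℂ :=
  X 0 * X 4 - 4 * X 1 * X 3 + 3 * X 2 ^ 2

/-- The invariant `J` of binary quartics, the determinant of the Hankel matrix. -/
def quarticJ : MvPolynomial (Fin (4 + 1)) ℂ :=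
  Matrix.det !![X 0, X 1, X 2; X 1, X 2, X 3; X 2, X 3, X 4]

end BinaryForms

end

noncomputable section

open MvPolynomial
open scoped MatrixGroups

namespace BinaryForms

/-! The quartics `4x³y - i x y³ - j y⁴` form a section on which `(I, J) = (i, j)`. Over `ℂ`, a form
with `f_4 ≠ 0` has a linear factor which a shear moves to give `f_0 = 0`; if then `f_1 ≠ 0`, a lower
triangular matrix carries the form into the section. Both nonvanishing conditions are removed by
continuity, so an invariant vanishing on the section is zero (`eq_zero_of_eval_weierstrass`).

For an invariant `P`, put `Q = P(0, 1, 0, -I/4, -J)`. It is a polynomial in `I` and `J` agreeing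
with `P` on the section, hence `P = Q`. Independence holds because `(I, J)` takes every value there.
The monomials `I^i J^j` are then a basis of the invariants, and counting those with `2i + 3j = m`
gives the Hilbert series. -/

/-- The binary quartic with prescribed normalised coefficients. -/
def quartic (c : Fin 5 → ℂ) : MvPolynomial (Fin 2) ℂ :=
  C (c 0) * X 0 ^ 4 + 4 * C (c 1) * X 0 ^ 3 * X 1 + 6 * C (c 2) * X 0 ^ 2 * X 1 ^ 2 +
    4 * C (c 3) * X 0 * X 1 ^ 3 + C (c 4) * X 1 ^ 4

theorem monomial_single_add_single (i j : ℕ) (a : ℂ) :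
    monomial (Finsupp.single (0 : Fin 2) i + Finsupp.single 1 j) a = C a * X 0 ^ i * X 1 ^ j := by
  rw [monomial_add_single, ← mul_one a, ← C_mul_monomial, ← zero_add (Finsupp.single 0 i),
    monomial_add_single]
  simp

theorem quartic_eq_sum (c : Fin 5 → ℂ) :
    quartic c = ∑ i : Fin 5, monomial (Finsupp.single 0 (4 - (i : ℕ)) + Finsupp.single 1 (i : ℕ))
      (((4).choose i : ℂ) * c i) := by
  have e6 : (C 6 : MvPolynomial (Fin 2) ℂ) = 6 := map_ofNat C 6
  have e4 : (C 4 : MvPolynomial (Fin 2) ℂ) = 4 := map_ofNat C 4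
  simp only [monomial_single_add_single, Fin.sum_univ_five, quartic]
  simp [Nat.choose, e6, e4]

theorem quartic_isHomogeneous (c : Fin 5 → ℂ) : (quartic c).IsHomogeneous 4 := by
  rw [quartic_eq_sum]
  refine IsHomogeneous.sum _ _ _ fun i _ => isHomogeneous_monomial _ ?_
  rw [map_add, Finsupp.degree_single, Finsupp.degree_single]
  omega

/-- `quartic c` as an element of the space of quartic forms. -/
def quarticForm (c : Fin 5 → ℂ) : Form 4 := ⟨quartic c, quartic_isHomogeneous c⟩

theorem exponent_injective (d : ℕ) :
    Function.Injective fun i : Fin (d + 1) =>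
      (Finsupp.single 0 (d - (i : ℕ)) + Finsupp.single 1 (i : ℕ) : Fin 2 →₀ ℕ) := by
  intro i j h
  have := DFunLike.congr_fun h 1
  simpa [Fin.ext_iff] using this

theorem coords_quarticForm (c : Fin 5 → ℂ) : coords 4 (quarticForm c) = c := by
  funext i
  have hi : ((4).choose i : ℂ) ≠ 0 := by
    exact_mod_cast (Nat.choose_pos (by omega)).ne'
  simp only [coords, quarticForm, quartic_eq_sum, coeff_sum, coeff_monomial]
  rw [Finset.sum_eq_single i]
  · simp [hi]
  · intro j _ hj
    exact if_neg fun h => hj (exponent_injective 4 h)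
  · simp

theorem quartic_coords (f : Form 4) : quartic (coords 4 f) = f := by
  ext e
  simp only [coords, quartic_eq_sum, coeff_sum, coeff_monomial]
  have hc (i : Fin 5) : ((4).choose i : ℂ) ≠ 0 := by
    exact_mod_cast (Nat.choose_pos (by omega)).ne'
  simp only [mul_div_cancel₀ _ (hc _)]
  by_cases he : e.degree = 4
  · have h2 : e 0 + e 1 = 4 := by
      rw [← he, Finsupp.degree_eq_sum, Fin.sum_univ_two]
    have he' : (Finsupp.single 0 (4 - e 1) + Finsupp.single 1 (e 1) : Fin 2 →₀ ℕ) = e := by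
      ext k
      fin_cases k
      · simp; omega
      · simp
    rw [Finset.sum_eq_single (⟨e 1, by omega⟩ : Fin 5)]
    · simp only [he', if_true]
    · intro j _ hj
      refine if_neg fun h => hj (exponent_injective 4 ?_)
      simp only [he', h]
    · simp
  · rw [IsHomogeneous.coeff_eq_zero f.2 he]
    refine Finset.sum_eq_zero fun i _ => if_neg ?_
    rintro rfl
    apply he
    rw [map_add, Finsupp.degree_single, Finsupp.degree_single]
    omega

/-! ### The action in coordinates -/

/-- The action on normalised coefficients of the substitution
`x_0 ↦ a x_0 + c x_1`, `x_1 ↦ b x_0 + d x_1`. -/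
def quarticAct (a b c d : ℂ) (f : Fin 5 → ℂ) : Fin 5 → ℂ :=
  ![f 0 * a ^ 4 + 4 * f 1 * a ^ 3 * b + 6 * f 2 * a ^ 2 * b ^ 2 + 4 * f 3 * a * b ^ 3 +
      f 4 * b ^ 4,
    f 0 * a ^ 3 * c + f 1 * (a ^ 3 * d + 3 * a ^ 2 * b * c) +
      f 2 * (3 * a ^ 2 * b * d + 3 * a * b ^ 2 * c) + f 3 * (3 * a * b ^ 2 * d + b ^ 3 * c) +
      f 4 * b ^ 3 * d,
    f 0 * a ^ 2 * c ^ 2 + f 1 * (2 * a ^ 2 * c * d + 2 * a * b * c ^ 2) +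
      f 2 * (a ^ 2 * d ^ 2 + 4 * a * b * c * d + b ^ 2 * c ^ 2) +
      f 3 * (2 * a * b * d ^ 2 + 2 * b ^ 2 * c * d) + f 4 * b ^ 2 * d ^ 2,
    f 0 * a * c ^ 3 + f 1 * (3 * a * c ^ 2 * d + b * c ^ 3) +
      f 2 * (3 * a * c * d ^ 2 + 3 * b * c ^ 2 * d) + f 3 * (a * d ^ 3 + 3 * b * c * d ^ 2) +
      f 4 * b * d ^ 3,
    f 0 * c ^ 4 + 4 * f 1 * c ^ 3 * d + 6 * f 2 * c ^ 2 * d ^ 2 + 4 * f 3 * c * d ^ 3 +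
      f 4 * d ^ 4]

theorem subst_quartic (g : SL(2, ℂ)) (f : Fin 5 → ℂ) :
    subst g (quartic f) = quartic (quarticAct (g 0 0) (g 0 1) (g 1 0) (g 1 1) f) := by
  simp only [quartic, quarticAct, subst, map_add, map_mul, map_pow, aeval_X, map_ofNat, algHom_C,
    algebraMap_eq, Fin.sum_univ_two, Matrix.cons_val]
  ring

theorem coords_formRep (g : SL(2, ℂ)) (f : Form 4) :
    coords 4 (formRep 4 g f) =
      quarticAct (g 0 0) (g 0 1) (g 1 0) (g 1 1) (coords 4 f) := by
  rw [← coords_quarticForm (quarticAct (g 0 0) (g 0 1) (g 1 0) (g 1 1) (coords 4 f))]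
  congr 1
  ext1
  refine Eq.trans ?_ (subst_quartic g (coords 4 f))
  rw [quartic_coords]
  rfl

theorem mem_invariantRing_four {P : MvPolynomial (Fin (4 + 1)) ℂ} :
    P ∈ invariantRing 4 ↔ ∀ (a b c d : ℂ), a * d - b * c = 1 → ∀ f : Fin 5 → ℂ,
      eval (quarticAct a b c d f) P = eval f P := by
  constructor
  · intro h a b c d hdet f
    obtain ⟨g, rfl, rfl, rfl, rfl⟩ :
        ∃ g : SL(2, ℂ), g 0 0 = a ∧ g 0 1 = b ∧ g 1 0 = c ∧ g 1 1 = d :=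
      ⟨⟨!![a, b; c, d], by rw [Matrix.det_fin_two_of, hdet]⟩, rfl, rfl, rfl, rfl⟩
    have := h g (quarticForm f)
    rwa [coords_formRep, coords_quarticForm] at this
  · intro h g f
    rw [coords_formRep]
    refine h _ _ _ _ ?_ _
    have := g.det_coe
    rwa [Matrix.det_fin_two] at this

/-! ### The invariants `I` and `J` -/

theorem eval_quarticI (f : Fin 5 → ℂ) :
    eval f quarticI = f 0 * f 4 - 4 * f 1 * f 3 + 3 * f 2 ^ 2 := by
  simp [quarticI]

theorem quarticJ_eq : quarticJ = X 0 * X 2 * X 4 + 2 * (X 1 * X 2 * X 3) - X 2 ^ 3 -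
    X 0 * X 3 ^ 2 - X 1 ^ 2 * X 4 := by
  simp only [quarticJ, Matrix.det_fin_three, Matrix.of_apply, Matrix.cons_val]
  ring

theorem eval_quarticJ (f : Fin 5 → ℂ) :
    eval f quarticJ = f 0 * f 2 * f 4 + 2 * (f 1 * f 2 * f 3) - f 2 ^ 3 -
      f 0 * f 3 ^ 2 - f 1 ^ 2 * f 4 := by
  simp [quarticJ_eq]

theorem quarticI_isHomogeneous : quarticI.IsHomogeneous 2 := by
  have h (i : Fin (4 + 1)) := isHomogeneous_X ℂ i
  have e4 : (4 : MvPolynomial (Fin (4 + 1)) ℂ) = C 4 := (map_ofNat C 4).symm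
  have e3 : (3 : MvPolynomial (Fin (4 + 1)) ℂ) = C 3 := (map_ofNat C 3).symm
  rw [quarticI, e4, e3]
  exact (((h 0).mul (h 4)).sub (((h 1).C_mul 4).mul (h 3))).add (((h 2).pow 2).C_mul 3)

theorem quarticJ_isHomogeneous : quarticJ.IsHomogeneous 3 := by
  have h (i : Fin (4 + 1)) := isHomogeneous_X ℂ i
  have e2 : (2 : MvPolynomial (Fin (4 + 1)) ℂ) = C 2 := (map_ofNat C 2).symm
  rw [quarticJ_eq, e2]
  exact ((((((h 0).mul (h 2)).mul (h 4)).add ((((h 1).mul (h 2)).mul (h 3)).C_mul 2)).sub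
    ((h 2).pow 3)).sub ((h 0).mul ((h 3).pow 2))).sub (((h 1).pow 2).mul (h 4))

theorem quarticI_mem : quarticI ∈ invariantRing 4 := by
  rw [mem_invariantRing_four]
  intro a b c d h f
  -- For an arbitrary matrix, `I` scales by `det ^ 4` (and `J` by `det ^ 6`): a polynomial identity,
  -- with `det = 1` used only afterwards.
  have : eval (quarticAct a b c d f) quarticI = (a * d - b * c) ^ 4 * eval f quarticI := by
    simp only [eval_quarticI, quarticAct, Matrix.cons_val]
    ring
  rw [this, h, one_pow, one_mul]

theorem quarticJ_mem : quarticJ ∈ invariantRing 4 := by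
  rw [mem_invariantRing_four]
  intro a b c d h f
  have : eval (quarticAct a b c d f) quarticJ = (a * d - b * c) ^ 6 * eval f quarticJ := by
    simp only [eval_quarticJ, quarticAct, Matrix.cons_val]
    ring
  rw [this, h, one_pow, one_mul]

/-! ### The Weierstrass section -/

/-- The Weierstrass section: the quartic with `f_0 = f_2 = 0`, `f_1 = 1` and invariants `i`, `j`. -/
def weierstrass (i j : ℂ) : Fin 5 → ℂ := ![0, 1, 0, -i / 4, -j]

theorem eval_weierstrass_quarticI (i j : ℂ) : eval (weierstrass i j) quarticI = i := by
  simp only [eval_quarticI, weierstrass, Matrix.cons_val]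
  ring

theorem eval_weierstrass_quarticJ (i j : ℂ) : eval (weierstrass i j) quarticJ = j := by
  simp only [eval_quarticJ, weierstrass, Matrix.cons_val]
  ring

/-- Evaluating a relation `Q(I, J) = 0` on the section shows that `Q` vanishes at every point of
`ℂ²`. -/
theorem algebraicIndependent_quarticI_quarticJ :
    AlgebraicIndependent ℂ ![quarticI, quarticJ] := by
  rw [algebraicIndependent_iff]
  intro Q hQ
  refine MvPolynomial.funext fun v => ?_
  have h := congrArg (eval (weierstrass (v 0) (v 1))) hQ
  rw [← MvPolynomial.coe_aeval_eq_eval, RingHom.coe_coe, ← AlgHom.comp_apply,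
    comp_aeval, map_zero] at h
  rw [map_zero, ← h, ← MvPolynomial.coe_aeval_eq_eval, RingHom.coe_coe]
  congr 2
  funext k
  fin_cases k
  · simp [eval_weierstrass_quarticI]
  · simp [eval_weierstrass_quarticJ]

/-- A polynomial vanishing at all points whose `i`-th coordinate is nonzero vanishes at every point
with the same other coordinates. -/
theorem eval_eq_zero_of_update {σ : Type*} [DecidableEq σ] (R : MvPolynomial σ ℂ) (i : σ)
    (f : σ → ℂ) (h : ∀ t : ℂ, t ≠ 0 → eval (Function.update f i t) R = 0) : eval f R = 0 := by
  have hc : Continuous fun t : ℂ => eval (Function.update f i t) R :=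
    (MvPolynomial.continuous_eval R).comp (continuous_const.update i continuous_id)
  have h0 := hc.ext_on (dense_compl_singleton (0 : ℂ)) continuous_const (g := fun _ => 0) h
  simpa using congrFun h0 (f i)

/-- A quartic with `f_0 = 0 ≠ f_1` is equivalent to a member of the Weierstrass section. -/
theorem eval_eq_zero_of_root {R : MvPolynomial (Fin (4 + 1)) ℂ} (hR : R ∈ invariantRing 4)
    (hW : ∀ i j, eval (weierstrass i j) R = 0) (f : Fin 5 → ℂ) (h0 : f 0 = 0) (h1 : f 1 ≠ 0) :
    eval f R = 0 := by
  rw [mem_invariantRing_four] at hR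
  -- With `f_0 = 0` and matrix entries `a = s`, `b = 0`, `d = s⁻¹`, the new `f_1` is `f_1 s²` and
  -- the new `f_2` is `2 f_1 s c + f_2`. The choices of `s` and `c` make these `1` and `0`.
  obtain ⟨s, hs⟩ := IsAlgClosed.exists_pow_nat_eq (f 1)⁻¹ (n := 2) two_pos
  have hs0 : s ≠ 0 := by
    rintro rfl
    exact h1 (by simpa using hs.symm)
  have hs1 : f 1 * s ^ 2 = 1 := by rw [hs, mul_inv_cancel₀ h1]
  set c : ℂ := -(f 2) / 2 * s with hc
  have hdet : s * s⁻¹ - 0 * c = 1 := by rw [mul_inv_cancel₀ hs0]; ring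
  rw [← hR s 0 c s⁻¹ hdet f]
  set f' := quarticAct s 0 c s⁻¹ f with hf'
  have h : f' = weierstrass (-4 * f' 3) (-f' 4) := by
    funext k
    fin_cases k
    · simp [hf', quarticAct, weierstrass, h0]
    · simp only [hf', quarticAct, weierstrass, h0]
      simp
      field_simp
      linear_combination hs1
    · simp only [hf', quarticAct, weierstrass, h0, hc]
      simp
      field_simp
      linear_combination -f 2 * hs1
    · simp [weierstrass]
    · simp [weierstrass]
  rw [h, hW]

/-- An invariant that vanishes on the Weierstrass section is zero. -/
theorem eq_zero_of_eval_weierstrass {R : MvPolynomial (Fin (4 + 1)) ℂ} (hR : R ∈ invariantRing 4)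
    (hW : ∀ i j, eval (weierstrass i j) R = 0) : R = 0 := by
  have hroot (f : Fin 5 → ℂ) (h0 : f 0 = 0) : eval f R = 0 :=
    eval_eq_zero_of_update R 1 f fun t ht =>
      eval_eq_zero_of_root hR hW _ (by simpa using h0) (by simpa using ht)
  refine MvPolynomial.funext fun f => ?_
  rw [map_zero]
  refine eval_eq_zero_of_update R 4 f fun t ht => ?_
  set f' := Function.update f 4 t
  have h4 : f' 4 ≠ 0 := by simpa [f'] using ht
  -- The polynomial is `f'(1, b)`, which is the new `f_0` under the shear by `b`; `f' 4 ≠ 0` makes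
  -- its degree 4, so a root exists.
  obtain ⟨b, hb⟩ := IsAlgClosed.exists_root
    (Polynomial.C (f' 4) * Polynomial.X ^ 4 + Polynomial.C (4 * f' 3) * Polynomial.X ^ 3 +
      Polynomial.C (6 * f' 2) * Polynomial.X ^ 2 + Polynomial.C (4 * f' 1) * Polynomial.X +
      Polynomial.C (f' 0))
    (by
      refine ne_of_eq_of_ne (b := 4) ?_ (by norm_num)
      compute_degree!)
  rw [← mem_invariantRing_four.1 hR 1 b 0 1 (by ring) f']
  apply hroot
  simp only [Polynomial.IsRoot.def, Polynomial.eval_add, Polynomial.eval_mul, Polynomial.eval_C,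
    Polynomial.eval_pow, Polynomial.eval_X] at hb
  simp only [quarticAct, Matrix.cons_val]
  linear_combination hb

/-! ### Generation by `I` and `J` -/

theorem adjoin_le_invariantRing :
    Algebra.adjoin ℂ {quarticI, quarticJ} ≤ invariantRing 4 := by
  rw [Algebra.adjoin_le_iff, Set.insert_subset_iff, Set.singleton_subset_iff]
  exact ⟨quarticI_mem, quarticJ_mem⟩

theorem invariantRing_four_eq :
    invariantRing 4 = Algebra.adjoin ℂ {quarticI, quarticJ} := by
  refine le_antisymm (fun P hP => ?_) adjoin_le_invariantRing
  -- the restriction of `P` to the Weierstrass section, as a polynomial in `I` and `J`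
  set Q : MvPolynomial (Fin (4 + 1)) ℂ :=
    aeval ![0, 1, 0, C (-1 / 4) * quarticI, -quarticJ] P with hQ
  have hQmem : Q ∈ Algebra.adjoin ℂ {quarticI, quarticJ} := by
    have hI : quarticI ∈ Algebra.adjoin ℂ {quarticI, quarticJ} :=
      Algebra.subset_adjoin (by simp)
    have hJ : quarticJ ∈ Algebra.adjoin ℂ {quarticI, quarticJ} :=
      Algebra.subset_adjoin (by simp)
    have hQ' := AlgHom.mem_range_self
      (aeval (R := ℂ) ![0, 1, 0, C (-1 / 4) * quarticI, -quarticJ]) P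
    rw [← Algebra.adjoin_range_eq_range_aeval] at hQ'
    refine Algebra.adjoin_le (Set.range_subset_iff.2 fun k => ?_) hQ'
    fin_cases k
    · exact zero_mem _
    · exact one_mem _
    · exact zero_mem _
    · exact mul_mem (Subalgebra.algebraMap_mem _ (-1 / 4 : ℂ)) hI
    · exact neg_mem hJ
  have hPQ : P - Q = 0 := by
    refine eq_zero_of_eval_weierstrass (sub_mem hP (adjoin_le_invariantRing hQmem)) fun i j => ?_
    rw [map_sub, sub_eq_zero, hQ, ← MvPolynomial.coe_aeval_eq_eval, RingHom.coe_coe,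
      ← AlgHom.comp_apply, comp_aeval]
    congr 2
    funext k
    fin_cases k
    · simp [weierstrass]
    · simp [weierstrass]
    · simp [weierstrass]
    · have := eval_weierstrass_quarticI i j
      simp [this]
      simp [weierstrass]
      ring
    · have := eval_weierstrass_quarticJ i j
      simp [this]
      simp [weierstrass]
  rwa [sub_eq_zero.1 hPQ]

/-! ### Graded pieces and the Hilbert series -/

/-- The exponents `(2 i, 3 j)` with `2 i + 3 j = m`. -/
def degreeIndex (m : ℕ) : Finset (ℕ × ℕ) :=
  (Finset.HasAntidiagonal.antidiagonal m).filter fun p => 2 ∣ p.1 ∧ 3 ∣ p.2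

theorem isHomogeneous_pow_mul_pow (i j : ℕ) :
    (quarticI ^ i * quarticJ ^ j).IsHomogeneous (2 * i + 3 * j) :=
  (quarticI_isHomogeneous.pow i).mul (quarticJ_isHomogeneous.pow j)

/-- These are the images of the monomials in two variables under evaluation at `(I, J)`, injective
by algebraic independence. -/
theorem linearIndependent_pow_mul_pow :
    LinearIndependent ℂ fun p : ℕ × ℕ => quarticI ^ p.1 * quarticJ ^ p.2 := by
  have h := (basisMonomials (Fin 2) ℂ).linearIndependent.map'
    (aeval ![quarticI, quarticJ]).toLinearMap
    (LinearMap.ker_eq_bot.2 algebraicIndependent_quarticI_quarticJ)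
  have hinj : Function.Injective fun p : ℕ × ℕ =>
      (Finsupp.single 0 p.1 + Finsupp.single 1 p.2 : Fin 2 →₀ ℕ) := by
    intro p q hpq
    have h0 := DFunLike.congr_fun hpq 0
    have h1 := DFunLike.congr_fun hpq 1
    exact Prod.ext (by simpa using h0) (by simpa using h1)
  have e : (fun p : ℕ × ℕ => quarticI ^ p.1 * quarticJ ^ p.2) =
      (fun e => aeval ![quarticI, quarticJ] (basisMonomials (Fin 2) ℂ e)) ∘
        fun p : ℕ × ℕ => Finsupp.single 0 p.1 + Finsupp.single 1 p.2 := by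
    funext p
    simp only [Function.comp_apply, coe_basisMonomials, monomial_single_add_single]
    simp
  rw [e]
  exact h.comp _ hinj

theorem adjoin_toSubmodule :
    Subalgebra.toSubmodule (Algebra.adjoin ℂ {quarticI, quarticJ}) =
      Submodule.span ℂ (Set.range fun p : ℕ × ℕ => quarticI ^ p.1 * quarticJ ^ p.2) := by
  rw [Algebra.adjoin_eq_span]
  congr 1
  ext P
  simp [Submonoid.mem_closure_pair]

theorem invariantsOfDegree_four_eq (m : ℕ) :
    invariantsOfDegree 4 m =
      Submodule.span ℂ (Set.range fun p : degreeIndex m =>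
        quarticI ^ (p.1.1 / 2) * quarticJ ^ (p.1.2 / 3)) := by
  rw [invariantsOfDegree, invariantRing_four_eq, adjoin_toSubmodule]
  apply le_antisymm
  · rintro P ⟨hP, hm⟩
    -- Projection to degree `m` fixes `P` and sends each `I^i J^j` to itself or to zero.
    have := Submodule.mem_map_of_mem (f := homogeneousComponent m) hP
    rw [homogeneousComponent_of_mem hm, if_pos rfl] at this
    refine (?_ : Submodule.map _ _ ≤ _) this
    rw [Submodule.map_span_le]
    rintro _ ⟨⟨i, j⟩, rfl⟩
    rw [homogeneousComponent_of_mem (isHomogeneous_pow_mul_pow i j)]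
    split_ifs with h
    · refine Submodule.subset_span ⟨⟨(2 * i, 3 * j), ?_⟩, ?_⟩
      · simp [degreeIndex, h]
      · simp
    · exact zero_mem _
  · rw [Submodule.span_le]
    rintro _ ⟨⟨p, hp⟩, rfl⟩
    simp only [degreeIndex, Finset.mem_filter, Finset.HasAntidiagonal.mem_antidiagonal] at hp
    refine ⟨Submodule.subset_span ⟨(p.1 / 2, p.2 / 3), rfl⟩, ?_⟩
    have h := isHomogeneous_pow_mul_pow (p.1 / 2) (p.2 / 3)
    rwa [Nat.mul_div_cancel' hp.2.1, Nat.mul_div_cancel' hp.2.2, hp.1] at h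

theorem finrank_invariantsOfDegree_four (m : ℕ) :
    Module.finrank ℂ (invariantsOfDegree 4 m) = (degreeIndex m).card := by
  rw [invariantsOfDegree_four_eq, finrank_span_eq_card, Fintype.card_coe]
  refine linearIndependent_pow_mul_pow.comp (fun p : degreeIndex m => (p.1.1 / 2, p.1.2 / 3)) ?_
  rintro ⟨p, hp⟩ ⟨q, hq⟩ h
  simp only [degreeIndex, Finset.mem_filter] at hp hq
  simp only [Prod.mk.injEq] at h
  refine Subtype.ext (Prod.ext ?_ ?_)
  · exact (Nat.div_left_inj hp.2.1 hq.2.1).1 h.1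
  · exact (Nat.div_left_inj hp.2.2 hq.2.2).1 h.2

/-- The series `∑ x ^ (k i)` is the inverse of `1 - x ^ k`. -/
theorem mk_dvd_mul_one_sub_X_pow {k : ℕ} (hk : 0 < k) :
    (PowerSeries.mk fun n => if k ∣ n then (1 : ℚ) else 0) * (1 - PowerSeries.X ^ k) = 1 := by
  ext n
  rw [mul_sub, mul_one, map_sub, PowerSeries.coeff_mul_X_pow', PowerSeries.coeff_mk,
    PowerSeries.coeff_one]
  by_cases hn : k ≤ n
  · rw [if_pos hn, PowerSeries.coeff_mk, if_neg (by omega : n ≠ 0)]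
    obtain ⟨r, rfl⟩ := Nat.exists_eq_add_of_le hn
    simp
  · rw [if_neg hn, sub_zero]
    congr 1
    refine propext ⟨fun h => Nat.eq_zero_of_dvd_of_lt h (by omega), ?_⟩
    rintro rfl
    exact dvd_zero k

theorem hilbertSeries_four :
    hilbertSeries 4 = ((1 - PowerSeries.X ^ 2) * (1 - PowerSeries.X ^ 3) : PowerSeries ℚ)⁻¹ := by
  -- Coefficients of a product are sums over the antidiagonal, hence the indexing of `degreeIndex`
  -- by `(2i, 3j)` rather than `(i, j)`.
  have h : hilbertSeries 4 = (PowerSeries.mk fun n => if 2 ∣ n then (1 : ℚ) else 0) *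
      PowerSeries.mk fun n => if 3 ∣ n then (1 : ℚ) else 0 := by
    ext m
    simp only [hilbertSeries, PowerSeries.coeff_mul, PowerSeries.coeff_mk,
      finrank_invariantsOfDegree_four, degreeIndex, Finset.card_filter, Nat.cast_sum]
    refine Finset.sum_congr rfl fun p _ => ?_
    by_cases h2 : 2 ∣ p.1 <;> by_cases h3 : 3 ∣ p.2 <;> simp [h2, h3]
  rw [PowerSeries.eq_inv_iff_mul_eq_one (by simp), h, mul_mul_mul_comm,
    mk_dvd_mul_one_sub_X_pow two_pos, mk_dvd_mul_one_sub_X_pow three_pos, one_mul]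

end BinaryForms

end

theorem mainTheorem1 :
    BinaryForms.hilbertSeries 4 =
        ((1 - PowerSeries.X ^ 2) * (1 - PowerSeries.X ^ 3) : PowerSeries ℚ)⁻¹ ∧
      BinaryForms.quarticI.IsHomogeneous 2 ∧
      BinaryForms.quarticJ.IsHomogeneous 3 ∧
      AlgebraicIndependent ℂ ![BinaryForms.quarticI, BinaryForms.quarticJ] ∧
      BinaryForms.invariantRing 4 =
        Algebra.adjoin ℂ {BinaryForms.quarticI, BinaryForms.quarticJ} := by
  exact ⟨BinaryForms.hilbertSeries_four, BinaryForms.quarticI_isHomogeneous,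
    BinaryForms.quarticJ_isHomogeneous, BinaryForms.algebraicIndependent_quarticI_quarticJ,
    BinaryForms.invariantRing_four_eq⟩
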